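/- Let $\Bbbk$ be an algebraically closed field of characteristic zero and let $n \ge 1$. On $V = \Bbbk^{2n}$ with basis $e_1,\dots,e_n,e'_n,\dots,e'_1$ take the symmetric bilinear form with $(e_i,e'_i)=(e'_i,e_i)=1$ and all other pairings of basis vectors equal to zero, and let $x_1,\dots,x_n,x'_n,\dots,x'_1$ be the coordinates on $V$ in this basis. Let $\mathrm{SO}_{2n}$ be the special orthogonal group of this form and $T\subset \mathrm{SO}_{2n}$ its maximal torus of matrices $\mathrm{diag}(t_1,\dots,t_n,t_n^{-1},\dots,t_1^{-1})$. On $\Bbbk^{2n-1}$ take the analogous form, with one additional basis vector $e$ that is orthogonal to the other basis vectors and has $(e,e)=1$. Let $\mathrm{SO}_{2n-1}$ be its special orthogonal group, embedded in $\mathrm{SO}_{2n}$ through an arbitrary isometric linear embedding $W:\Bbbk^{2n-1}\to V$, with trivial action on the orthogonal complement of the image of $W$. Let ${}^{T}\Bbbk[\mathrm{SO}_{2n}]^{\mathrm{SO}_{2n-1}}$ be the algebra of regular functions on $\mathrm{SO}_{2n}$ that are invariant under the action $(t,h)\circ g=tgh^{-1}$ of $T\times \mathrm{SO}_{2n-1}$,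 and let $T\backslash\backslash \mathrm{SO}_{2n}/\!/\mathrm{SO}_{2n-1}$ be its spectrum. Then: 1. the algebra ${}^{T}\Bbbk[\mathrm{SO}_{2n}]^{\mathrm{SO}_{2n-1}}$ is free: it is isomorphic to the polynomial algebra over $\Bbbk$ in $n-1$ variables; 2. $T\backslash\backslash \mathrm{SO}_{2n}/\!/\mathrm{SO}_{2n-1}$ is isomorphic, over $\Bbbk$, to the affine space $\mathbb{A}^{n-1}$; 3. the algebra $\Bbbk[V]^T$ is freely generated by $z_i=x_ix'_i$, $i=1,\dots,n$. If $v\in V$ is orthogonal to the image of $W$ and $\sum_i x_i(v)x'_i(v)=1$, then the map $g\mapsto gv$ from $\mathrm{SO}_{2n}$ to the quadric $\{\sum_i x_ix'_i=1\}\subset V$ induces a surjective homomorphism $\Bbbk[V]^T\to {}^{T}\Bbbk[\mathrm{SO}_{2n}]^{\mathrm{SO}_{2n-1}}$ whose kernel is generated by $z_1+\dots+z_n-1$. Thus it identifies $T\backslash\backslash \mathrm{SO}_{2n}/\!/\mathrm{SO}_{2n-1}$ with the hyperplane $z_1+\dots+z_n=1$ in $V/\!/T=\operatorname{Spec}\Bbbk[V]^T$.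 -/

import Mathlib

open AlgebraicGeometry CategoryTheory

namespace DoubleCoset

universe u

variable {k : Type u} [Field k]

/-- The Gram matrix of the symmetric bilinear form on `k^{2n}` with basis
`e_1, …, e_n` (indices `inl i`) and `e'_1, …, e'_n` (indices `inr i`) such that
`(e_i, e'_i) = (e'_i, e_i) = 1` and all other pairings of basis vectors vanish. -/
def evenForm (k : Type u) [Field k] (n : ℕ) : Matrix (Fin n ⊕ Fin n) (Fin n ⊕ Fin n) k :=
  Matrix.fromBlocks 0 1 1 0

/-- The Gram matrix of the symmetric bilinear form on `k^{2m+1}` with basis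
`e_1, …, e_m`, `e'_1, …, e'_m` and `e`: the pairings of the `e_i` and `e'_i` are those of
`evenForm`, `e` is orthogonal to all of them, and `(e, e) = 1`. -/
def oddForm (k : Type u) [Field k] (m : ℕ) :
    Matrix ((Fin m ⊕ Fin m) ⊕ Unit) ((Fin m ⊕ Fin m) ⊕ Unit) k :=
  Matrix.fromBlocks (evenForm k m) 0 0 1

/-- The special orthogonal group of the bilinear form with Gram matrix `S`: the matrices of
determinant one that preserve the form. -/
def specialIsometryGroup {ι : Type*} [Fintype ι] [DecidableEq ι] (S : Matrix ι ι k) :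
    Subgroup (Matrix.SpecialLinearGroup ι k) where
  carrier := {g | (g : Matrix ι ι k).transpose * S * (g : Matrix ι ι k) = S}
  one_mem' := by simp
  mul_mem' := by
    intro a b ha hb
    simp only [Set.mem_ofPred_eq, Matrix.SpecialLinearGroup.coe_mul,
      Matrix.transpose_mul] at *
    calc _ = (b : Matrix ι ι k).transpose *
          ((a : Matrix ι ι k).transpose * S * (a : Matrix ι ι k)) * (b : Matrix ι ι k) := by
            simp only [Matrix.mul_assoc]
      _ = S := by rw [ha, hb]
  inv_mem' := by
    intro a ha
    simp only [Set.mem_ofPred_eq] at *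
    have h1 : (a : Matrix ι ι k) * ((a⁻¹ : Matrix.SpecialLinearGroup ι k) : Matrix ι ι k) = 1 := by
      rw [← Matrix.SpecialLinearGroup.coe_mul, mul_inv_cancel,
        Matrix.SpecialLinearGroup.coe_one]
    have h2 : ((a⁻¹ : Matrix.SpecialLinearGroup ι k) : Matrix ι ι k).transpose *
        (a : Matrix ι ι k).transpose = 1 := by
      rw [← Matrix.transpose_mul, h1, Matrix.transpose_one]
    generalize ((a⁻¹ : Matrix.SpecialLinearGroup ι k) : Matrix ι ι k) = b at h1 h2 ⊢
    calc b.transpose * S * b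
        = b.transpose * ((a : Matrix ι ι k).transpose * S * (a : Matrix ι ι k)) * b := by rw [ha]
      _ = (b.transpose * (a : Matrix ι ι k).transpose) * S * ((a : Matrix ι ι k) * b) := by
          simp only [Matrix.mul_assoc]
      _ = S := by rw [h1, h2]; simp

/-- `SO_{2n}` over `k`. -/
abbrev SOEven (k : Type u) [Field k] (n : ℕ) :
    Subgroup (Matrix.SpecialLinearGroup (Fin n ⊕ Fin n) k) :=
  specialIsometryGroup (evenForm k n)

/-- `SO_{2m+1}` over `k`. -/
abbrev SOOdd (k : Type u) [Field k] (m : ℕ) :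
    Subgroup (Matrix.SpecialLinearGroup ((Fin m ⊕ Fin m) ⊕ Unit) k) :=
  specialIsometryGroup (oddForm k m)

/-- The underlying matrix of an element of a special orthogonal group. -/
abbrev toMat {ι : Type*} [Fintype ι] [DecidableEq ι] {S : Matrix ι ι k}
    (g : specialIsometryGroup S) : Matrix ι ι k :=
  ((g : Matrix.SpecialLinearGroup ι k) : Matrix ι ι k)

theorem toMat_mul {ι : Type*} [Fintype ι] [DecidableEq ι] {S : Matrix ι ι k}
    (g h : specialIsometryGroup S) : toMat (g * h) = toMat g * toMat h := by
  simp [toMat]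

theorem toMat_inv_mul {ι : Type*} [Fintype ι] [DecidableEq ι] {S : Matrix ι ι k}
    (g : specialIsometryGroup S) : toMat g⁻¹ * toMat g = 1 := by
  rw [← toMat_mul, inv_mul_cancel]; simp [toMat]

theorem toMat_mul_inv {ι : Type*} [Fintype ι] [DecidableEq ι] {S : Matrix ι ι k}
    (g : specialIsometryGroup S) : toMat g * toMat g⁻¹ = 1 := by
  rw [← toMat_mul, mul_inv_cancel]; simp [toMat]

/-- The diagonal maximal torus of `SO_{2n}`: it acts on `e_i` by `t_i` and on `e'_i` by `t_i⁻¹`. -/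
def diagonalTorus (k : Type u) [Field k] (n : ℕ) : Subgroup (SOEven k n) where
  carrier := {g | ∃ t : Fin n → kˣ, toMat g = Matrix.diagonal
    (Sum.elim (fun i => (t i : k)) (fun i => ((t i)⁻¹ : kˣ)))}
  one_mem' := ⟨1, by
    simp only [toMat, OneMemClass.coe_one, Matrix.SpecialLinearGroup.coe_one]
    rw [← Matrix.diagonal_one]
    congr 1; ext (i | i) <;> simp⟩
  mul_mem' := by
    rintro a b ⟨s, hs⟩ ⟨t, ht⟩
    refine ⟨s * t, ?_⟩
    rw [toMat_mul, hs, ht, Matrix.diagonal_mul_diagonal]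
    congr 1; ext (i | i) <;> simp [mul_comm]
  inv_mem' := by
    rintro a ⟨s, hs⟩
    refine ⟨s⁻¹, ?_⟩
    have h := toMat_inv_mul a
    rw [hs] at h
    refine (left_inv_eq_right_inv h ?_)
    rw [Matrix.diagonal_mul_diagonal, ← Matrix.diagonal_one]
    congr 1; ext (i | i) <;> simp

/-- The subgroup `SO_{2m+1}` of `SO_{2n}` attached to a linear map `W : k^{2m+1} → k^{2n}`
(used for `W` an isometric embedding): the elements that act on the image of `W` through an
element of `SO_{2m+1}`, and trivially on the orthogonal complement of that image. -/
def embeddedSOOdd {n m : ℕ} (W : Matrix (Fin n ⊕ Fin n) ((Fin m ⊕ Fin m) ⊕ Unit) k) :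
    Subgroup (SOEven k n) where
  carrier := {g | (∃ h : SOOdd k m, toMat g * W = W * toMat h) ∧
    ∀ v : Fin n ⊕ Fin n → k,
      W.transpose.mulVec ((evenForm k n).mulVec v) = 0 → (toMat g).mulVec v = v}
  one_mem' := ⟨⟨1, by simp [toMat]⟩, fun v _ => by simp [toMat]⟩
  mul_mem' := by
    rintro a b ⟨⟨s, hs⟩, ha⟩ ⟨⟨t, ht⟩, hb⟩
    refine ⟨⟨s * t, ?_⟩, fun v hv => ?_⟩
    · rw [toMat_mul, toMat_mul, Matrix.mul_assoc, ht, ← Matrix.mul_assoc, hs, Matrix.mul_assoc]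
    · rw [toMat_mul, ← Matrix.mulVec_mulVec, hb v hv, ha v hv]
  inv_mem' := by
    rintro a ⟨⟨s, hs⟩, ha⟩
    refine ⟨⟨s⁻¹, ?_⟩, fun v hv => ?_⟩
    · calc toMat a⁻¹ * W = toMat a⁻¹ * (W * toMat s) * toMat s⁻¹ := by
            rw [Matrix.mul_assoc, Matrix.mul_assoc, toMat_mul_inv, Matrix.mul_one]
        _ = W * toMat s⁻¹ := by
            rw [← hs, ← Matrix.mul_assoc (toMat a⁻¹), toMat_inv_mul, Matrix.one_mul]
    · conv_lhs => rw [← ha v hv]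
      rw [Matrix.mulVec_mulVec, toMat_inv_mul, Matrix.one_mulVec]

/-- The algebra `k[G]` of regular functions on a special orthogonal group: the functions that are
polynomial in the matrix entries. -/
def regularFunctions {ι : Type*} [Fintype ι] [DecidableEq ι] (S : Matrix ι ι k) :
    Subalgebra k (specialIsometryGroup S → k) :=
  Algebra.adjoin k (Set.range fun (p : ι × ι) (g : specialIsometryGroup S) => toMat g p.1 p.2)

/-- The algebra of regular functions on `G` that are invariant under the action
`(a, b) ∘ g = a g b⁻¹` of `F × H`. -/
def doubleInvariants {ι : Type*} [Fintype ι] [DecidableEq ι] {S : Matrix ι ι k}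
    (F H : Subgroup (specialIsometryGroup S)) :
    Subalgebra k (specialIsometryGroup S → k) where
  carrier := {f | f ∈ regularFunctions S ∧ ∀ a ∈ F, ∀ b ∈ H, ∀ g, f (a * g * b⁻¹) = f g}
  mul_mem' := fun hf hf' => ⟨mul_mem hf.1 hf'.1, fun a ha b hb g => by
    simp only [Pi.mul_apply, hf.2 a ha b hb g, hf'.2 a ha b hb g]⟩
  add_mem' := fun hf hf' => ⟨add_mem hf.1 hf'.1, fun a ha b hb g => by
    simp only [Pi.add_apply, hf.2 a ha b hb g, hf'.2 a ha b hb g]⟩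
  algebraMap_mem' := fun c => ⟨Subalgebra.algebraMap_mem _ c, fun _ _ _ _ _ => rfl⟩

/-- The double coset variety `F \\ G // H`, the spectrum of the algebra of invariants,
as a scheme over `k`. -/
noncomputable def doubleCosetVariety {ι : Type} [Fintype ι] [DecidableEq ι] {S : Matrix ι ι k}
    (F H : Subgroup (specialIsometryGroup S)) : Over (Spec (CommRingCat.of k)) :=
  Over.mk (Spec.map (CommRingCat.ofHom (algebraMap k (doubleInvariants F H))))

/-- Affine space of dimension `d` as a scheme over `k`. -/
noncomputable def affineSpaceOver (k : Type u) [Field k] (d : ℕ) :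
    Over (Spec (CommRingCat.of k)) :=
  Over.mk (AffineSpace (ULift.{u} (Fin d)) (Spec (CommRingCat.of k)) ↘ Spec (CommRingCat.of k))

/-- The algebra `k[V]^T` of polynomials on `V = k^{2n}` invariant under the diagonal torus. -/
noncomputable def torusInvariants (k : Type u) [Field k] (n : ℕ) :
    Subalgebra k (MvPolynomial (Fin n ⊕ Fin n) k) where
  carrier := {p | ∀ t ∈ diagonalTorus k n, ∀ y : Fin n ⊕ Fin n → k,
    MvPolynomial.eval ((toMat t).mulVec y) p = MvPolynomial.eval y p}
  mul_mem' := fun hp hq t ht y => by rw [map_mul, map_mul, hp t ht y, hq t ht y]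
  add_mem' := fun hp hq t ht y => by rw [map_add, map_add, hp t ht y, hq t ht y]
  algebraMap_mem' := fun c t _ y => by simp [MvPolynomial.algebraMap_eq]

/-- The homomorphism `k[Z_1, …, Z_n] → k[V]`, `Z_i ↦ x_i x'_i`. -/
noncomputable def zHom (k : Type u) [Field k] (n : ℕ) :
    MvPolynomial (Fin n) k →ₐ[k] MvPolynomial (Fin n ⊕ Fin n) k :=
  MvPolynomial.aeval fun i => MvPolynomial.X (Sum.inl i) * MvPolynomial.X (Sum.inr i)

/-- The pullback of polynomials on `V = k^{2n}` to functions on `SO_{2n}` along the orbit map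
`g ↦ g v`. -/
noncomputable def orbitPullback {n : ℕ} (v : Fin n ⊕ Fin n → k) :
    MvPolynomial (Fin n ⊕ Fin n) k →ₐ[k] (SOEven k n → k) :=
  MvPolynomial.aeval fun j g => (toMat g).mulVec v j

end DoubleCoset

/-! A normal vector `v` of the image of `W`, scaled to norm `2`, spans the orthogonal complement, so
the embedded odd group is the stabilizer of `v` (`mem_embeddedSOOdd_iff`). The orbit of `v` is the
quadric of norm `2`, that is `∑ x_i x'_i = 1`.

The orbit map has two rational sections `q ↦ ε r_{q + εv} r_v`, `ε = ±1`, with denominators powers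
of `2 ± (v, q)`. These two linear functions add up to `4`, so Bézout glues the two pullbacks of a
right-invariant regular function into one polynomial in `g v`
(`exists_polynomial_of_stabilizer_invariant`).

By independence of characters, left torus invariance allows that polynomial to be replaced by its
weight zero part, a polynomial in the `z_i` (`eval_weightZeroPart_of_forall`). Every point of the
hyperplane `∑ z_i = 1` comes from the quadric, so the only relations are those that vanish on this
hyperplane (`ker_orbitPullback_comp_zHom`). -/

namespace DoubleCoset

open Matrix

/-! ### Reflections, sections of the orbit map, and descent to the quadric. -/

section Reflections

variable {k ι : Type*} [Field k]

/-- The functions on `k^ι` given by polynomials. -/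
noncomputable def polynomialFunctions (k ι : Type*) [Field k] : Subalgebra k ((ι → k) → k) :=
  (MvPolynomial.aeval fun (i : ι) (y : ι → k) => y i).range

theorem mem_polynomialFunctions {f : (ι → k) → k} :
    f ∈ polynomialFunctions k ι ↔ ∃ p : MvPolynomial ι k, ∀ y, f y = MvPolynomial.eval y p := by
  have key (p : MvPolynomial ι k) (y : ι → k) :
      (MvPolynomial.aeval fun (i : ι) (y : ι → k) => y i) p y = MvPolynomial.eval y p := by
    induction p using MvPolynomial.induction_on with
    | C a => simp
    | add p q hp hq => simp [hp, hq]
    | mul_X p i hp => simp [hp]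
  constructor
  · rintro ⟨p, rfl⟩
    exact ⟨p, fun y => key p y⟩
  · rintro ⟨p, hp⟩
    exact ⟨p, funext fun y => (key p y).trans (hp y).symm⟩

theorem coordinate_mem_polynomialFunctions (i : ι) :
    (fun y : ι → k => y i) ∈ polynomialFunctions k ι :=
  mem_polynomialFunctions.2 ⟨MvPolynomial.X i, fun y => by simp⟩

theorem const_mem_polynomialFunctions (c : k) :
    (fun _ : ι → k => c) ∈ polynomialFunctions k ι :=
  mem_polynomialFunctions.2 ⟨MvPolynomial.C c, fun y => by simp⟩

variable [Fintype ι]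

theorem dotProduct_mulVec_symm {S : Matrix ι ι k} (hS : S.transpose = S) (x y : ι → k) :
    x ⬝ᵥ S *ᵥ y = y ⬝ᵥ S *ᵥ x := by
  rw [dotProduct_mulVec, ← mulVec_transpose, hS, dotProduct_comm]

variable [DecidableEq ι]

/-- The matrix of `x ↦ x - c (a, x) a`; it is the reflection along `a` if `c (a, a) = 2`. -/
def reflectionMatrix (S : Matrix ι ι k) (a : ι → k) (c : k) : Matrix ι ι k :=
  1 - c • vecMulVec a (S *ᵥ a)

theorem reflectionMatrix_mulVec {S : Matrix ι ι k} (hS : S.transpose = S) (a x : ι → k) (c : k) :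
    reflectionMatrix S a c *ᵥ x = x - (c * (a ⬝ᵥ S *ᵥ x)) • a := by
  rw [reflectionMatrix, sub_mulVec, one_mulVec, smul_mulVec, vecMulVec_mulVec,
    dotProduct_comm, dotProduct_mulVec_symm hS]
  ext i
  simp only [Pi.sub_apply, Pi.smul_apply, MulOpposite.smul_eq_mul_unop, MulOpposite.unop_op,
    smul_eq_mul]
  ring

theorem reflectionMatrix_isometry {S : Matrix ι ι k} (hS : S.transpose = S) {a : ι → k} {c : k}
    (hc : c * (a ⬝ᵥ S *ᵥ a) = 2) :
    (reflectionMatrix S a c).transpose * S * reflectionMatrix S a c = S := by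
  have h1 : S * reflectionMatrix S a c = S - c • vecMulVec (S *ᵥ a) (S *ᵥ a) := by
    rw [reflectionMatrix, mul_sub, mul_one, mul_smul_comm, mul_vecMulVec]
  have h2 : (reflectionMatrix S a c).transpose = 1 - c • vecMulVec (S *ᵥ a) a := by
    rw [reflectionMatrix, transpose_sub, transpose_one, transpose_smul, transpose_vecMulVec]
  have h3 : vecMulVec (S *ᵥ a) a * S = vecMulVec (S *ᵥ a) (S *ᵥ a) := by
    rw [vecMulVec_mul, ← mulVec_transpose, hS]
  rw [Matrix.mul_assoc, h1, h2, sub_mul, one_mul, smul_mul_assoc, mul_sub, h3, mul_smul_comm,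
    vecMulVec_mul_vecMulVec]
  ext i j
  simp only [Matrix.sub_apply, Matrix.smul_apply, vecMulVec_apply, Pi.smul_apply, smul_eq_mul]
  linear_combination (c * (S *ᵥ a) i * (S *ᵥ a) j) * hc

theorem det_reflectionMatrix {S : Matrix ι ι k} {a : ι → k} {c : k}
    (hc : c * (a ⬝ᵥ S *ᵥ a) = 2) : (reflectionMatrix S a c).det = -1 := by
  have h : reflectionMatrix S a c =
      1 + replicateCol Unit (-c • a) * replicateRow Unit (S *ᵥ a) := by
    rw [← vecMulVec_eq, smul_vecMulVec, reflectionMatrix, neg_smul, sub_eq_add_neg]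
  rw [h, det_one_add_replicateCol_mul_replicateRow, dotProduct_smul, dotProduct_comm]
  simp only [smul_eq_mul]
  linear_combination -hc

/-- The matrix `ε r_{q + εv} r_v`, where `r_a` is the reflection along `a`. -/
def orbitSection (S : Matrix ι ι k) (v : ι → k) (ε : k) (q : ι → k) : Matrix ι ι k :=
  ε • (reflectionMatrix S (q + ε • v) (2 + ε * (v ⬝ᵥ S *ᵥ q))⁻¹ * reflectionMatrix S v 1)

section

variable {S : Matrix ι ι k} {v q : ι → k} {ε : k}

-- On the quadric, `q + εv` has norm `2 (2 + ε (v, q))`; this is what makes the scalar in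
-- `orbitSection` that of a genuine reflection.
omit [DecidableEq ι] in
theorem inv_mul_dotProduct_add_smul (hS : S.transpose = S) (hε : ε * ε = 1)
    (hv : v ⬝ᵥ S *ᵥ v = 2) (hq : q ⬝ᵥ S *ᵥ q = 2) (hl : 2 + ε * (v ⬝ᵥ S *ᵥ q) ≠ 0) :
    (2 + ε * (v ⬝ᵥ S *ᵥ q))⁻¹ * ((q + ε • v) ⬝ᵥ S *ᵥ (q + ε • v)) = 2 := by
  have : (q + ε • v) ⬝ᵥ S *ᵥ (q + ε • v) = (2 + ε * (v ⬝ᵥ S *ᵥ q)) * 2 := by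
    simp only [mulVec_add, mulVec_smul, dotProduct_add, add_dotProduct, smul_dotProduct,
      dotProduct_smul, smul_eq_mul, hv, hq, dotProduct_mulVec_symm hS q v]
    linear_combination 2 * hε
  rw [this, inv_mul_cancel_left₀ hl]

theorem orbitSection_isometry (hS : S.transpose = S) (hε : ε * ε = 1)
    (hv : v ⬝ᵥ S *ᵥ v = 2) (hq : q ⬝ᵥ S *ᵥ q = 2) (hl : 2 + ε * (v ⬝ᵥ S *ᵥ q) ≠ 0) :
    (orbitSection S v ε q).transpose * S * orbitSection S v ε q = S := by
  have h1 := reflectionMatrix_isometry hS (inv_mul_dotProduct_add_smul hS hε hv hq hl)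
  have h2 := reflectionMatrix_isometry (c := 1) hS ((one_mul _).trans hv)
  rw [orbitSection]
  set A := reflectionMatrix S (q + ε • v) (2 + ε * (v ⬝ᵥ S *ᵥ q))⁻¹
  set B := reflectionMatrix S v 1
  calc _ = (ε * ε) • (B.transpose * (A.transpose * S * A) * B) := by
        simp only [transpose_smul, transpose_mul, smul_mul_assoc, mul_smul_comm, smul_smul,
          Matrix.mul_assoc]
    _ = S := by rw [h1, h2, hε, one_smul]

/-- The two reflections contribute `(-1)(-1)`, and the scalar `ε` contributes an even power of `ε`.
-/
theorem det_orbitSection (hS : S.transpose = S) (hι : Even (Fintype.card ι)) (hε : ε * ε = 1)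
    (hv : v ⬝ᵥ S *ᵥ v = 2) (hq : q ⬝ᵥ S *ᵥ q = 2) (hl : 2 + ε * (v ⬝ᵥ S *ᵥ q) ≠ 0) :
    (orbitSection S v ε q).det = 1 := by
  obtain ⟨r, hr⟩ := hι
  rw [orbitSection, det_smul, det_mul,
    det_reflectionMatrix (inv_mul_dotProduct_add_smul hS hε hv hq hl),
    det_reflectionMatrix ((one_mul _).trans hv), hr, pow_add, ← mul_pow, hε]
  simp

/-- The section property: `r_v` sends `v` to `-v`, `r_{q + εv}` sends `-v` to `εq`, and the scalar
`ε` removes the sign. -/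
theorem orbitSection_mulVec (hS : S.transpose = S) (hε : ε * ε = 1)
    (hv : v ⬝ᵥ S *ᵥ v = 2) (hl : 2 + ε * (v ⬝ᵥ S *ᵥ q) ≠ 0) :
    orbitSection S v ε q *ᵥ v = q := by
  have h : (2 + ε * (v ⬝ᵥ S *ᵥ q))⁻¹ * ((q + ε • v) ⬝ᵥ S *ᵥ v) = ε := by
    rw [inv_mul_eq_iff_eq_mul₀ hl, add_dotProduct, smul_dotProduct, hv,
      dotProduct_mulVec_symm hS q v, smul_eq_mul]
    linear_combination -(v ⬝ᵥ S *ᵥ q) * hε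
  rw [orbitSection, smul_mulVec, ← mulVec_mulVec, reflectionMatrix_mulVec hS v v, hv,
    show v - (1 * 2 : k) • v = -v by rw [one_mul, two_smul]; abel, mulVec_neg,
    reflectionMatrix_mulVec hS, h]
  ext i
  simp only [Pi.sub_apply, Pi.smul_apply, Pi.neg_apply, Pi.add_apply, smul_eq_mul]
  linear_combination (q i + ε * v i) * hε

omit [DecidableEq ι] in
theorem dotProduct_mem_polynomialFunctions (w : ι → k) :
    (fun y : ι → k => w ⬝ᵥ y) ∈ polynomialFunctions k ι :=
  mem_polynomialFunctions.2 ⟨∑ i, MvPolynomial.C (w i) * MvPolynomial.X i, fun y => by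
    simp [dotProduct]⟩

omit [DecidableEq ι] in
theorem denominator_mem_polynomialFunctions (S : Matrix ι ι k) (v : ι → k) (ε : k) :
    (fun q : ι → k => 2 + ε * (v ⬝ᵥ S *ᵥ q)) ∈ polynomialFunctions k ι := by
  simp only [dotProduct_mulVec]
  exact add_mem (const_mem_polynomialFunctions 2)
    (mul_mem (const_mem_polynomialFunctions ε) (dotProduct_mem_polynomialFunctions _))

/-- Only the reflection along `q + εv` depends on `q`, and it contains the inverse just once, so one
factor clears it. -/
theorem exists_denominator_mul_orbitSection (S : Matrix ι ι k) (v : ι → k) (ε : k) (i j : ι) :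
    ∃ f ∈ polynomialFunctions k ι, ∀ q, 2 + ε * (v ⬝ᵥ S *ᵥ q) ≠ 0 →
      (2 + ε * (v ⬝ᵥ S *ᵥ q)) * orbitSection S v ε q i j = f q := by
  have hcoord (l : ι) : (fun q : ι → k => (q + ε • v) l) ∈ polynomialFunctions k ι :=
    add_mem (coordinate_mem_polynomialFunctions l) (const_mem_polynomialFunctions _)
  have hlin (l : ι) : (fun q : ι → k => (S *ᵥ (q + ε • v)) l) ∈ polynomialFunctions k ι := by
    simp only [mulVec_add, Pi.add_apply]
    exact add_mem (dotProduct_mem_polynomialFunctions _) (const_mem_polynomialFunctions _)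
  refine ⟨fun q => ε * ∑ l, ((2 + ε * (v ⬝ᵥ S *ᵥ q)) * (1 : Matrix ι ι k) i l -
      (q + ε • v) i * (S *ᵥ (q + ε • v)) l) * reflectionMatrix S v 1 l j,
    mul_mem (const_mem_polynomialFunctions ε) ?_, fun q hq => ?_⟩
  · have : (fun q : ι → k => ∑ l, ((2 + ε * (v ⬝ᵥ S *ᵥ q)) * (1 : Matrix ι ι k) i l -
        (q + ε • v) i * (S *ᵥ (q + ε • v)) l) * reflectionMatrix S v 1 l j) =
        ∑ l, fun q : ι → k => ((2 + ε * (v ⬝ᵥ S *ᵥ q)) * (1 : Matrix ι ι k) i l -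
        (q + ε • v) i * (S *ᵥ (q + ε • v)) l) * reflectionMatrix S v 1 l j := by
      ext q; rw [Finset.sum_apply]
    rw [this]
    exact sum_mem fun l _ => mul_mem (sub_mem (mul_mem (denominator_mem_polynomialFunctions S v ε)
      (const_mem_polynomialFunctions _)) (mul_mem (hcoord i) (hlin l)))
      (const_mem_polynomialFunctions _)
  · rw [orbitSection, Matrix.smul_apply, mul_apply, smul_eq_mul, mul_left_comm, Finset.mul_sum]
    congr 1
    refine Finset.sum_congr rfl fun l _ => ?_
    rw [← mul_assoc]
    congr 1
    rw [reflectionMatrix, Matrix.sub_apply, Matrix.smul_apply, vecMulVec_apply, smul_eq_mul, mul_sub,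
      mul_inv_cancel_left₀ hq]

/-- The pullback of a regular function along the rational section `q ↦ ε r_{q + εv} r_v`
is a rational function whose denominator is a power of `2 + ε (v, q)`. -/
theorem exists_denominator_pow_mul_section {F : specialIsometryGroup S → k}
    (hF : F ∈ regularFunctions S) (v : ι → k) (ε : k) :
    ∃ (N : ℕ), ∃ f ∈ polynomialFunctions k ι, ∀ q, 2 + ε * (v ⬝ᵥ S *ᵥ q) ≠ 0 →
      ∀ g : specialIsometryGroup S, toMat g = orbitSection S v ε q →
        (2 + ε * (v ⬝ᵥ S *ᵥ q)) ^ N * F g = f q := by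
  have hd := denominator_mem_polynomialFunctions S v ε
  induction hF using Algebra.adjoin_induction with
  | mem x hx =>
    obtain ⟨⟨i, j⟩, rfl⟩ := hx
    obtain ⟨f, hf, h⟩ := exists_denominator_mul_orbitSection S v ε i j
    exact ⟨1, f, hf, fun q hq g hg => by simp only [pow_one, hg, h q hq]⟩
  | algebraMap r =>
    exact ⟨0, _, const_mem_polynomialFunctions r, fun q hq g hg => by simp⟩
  | add x y _ _ hx hy =>
    obtain ⟨M, f, hf, h⟩ := hx
    obtain ⟨N, f', hf', h'⟩ := hy
    refine ⟨M + N, _, add_mem (mul_mem (pow_mem hd N) hf) (mul_mem (pow_mem hd M) hf'),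
      fun q hq g hg => ?_⟩
    simp only [Pi.add_apply, Pi.mul_apply, Pi.pow_apply, ← h q hq g hg, ← h' q hq g hg]
    ring
  | mul x y _ _ hx hy =>
    obtain ⟨M, f, hf, h⟩ := hx
    obtain ⟨N, f', hf', h'⟩ := hy
    refine ⟨M + N, _, mul_mem hf hf', fun q hq g hg => ?_⟩
    simp only [Pi.mul_apply, ← h q hq g hg, ← h' q hq g hg]
    ring

theorem dotProduct_toMat_mulVec (g : specialIsometryGroup S) (x y : ι → k) :
    (toMat g *ᵥ x) ⬝ᵥ S *ᵥ (toMat g *ᵥ y) = x ⬝ᵥ S *ᵥ y := by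
  have hg : (toMat g).transpose * S * toMat g = S := g.2
  conv_rhs => rw [← hg]
  rw [dotProduct_comm, dotProduct_mulVec, ← mulVec_transpose, dotProduct_comm, mulVec_mulVec,
    mulVec_mulVec, Matrix.mul_assoc]

/-- The matrix `ε r_{q + εv} r_v` belongs to the special orthogonal group. -/
theorem exists_toMat_eq_orbitSection (hS : S.transpose = S) (hι : Even (Fintype.card ι))
    (hε : ε * ε = 1) (hv : v ⬝ᵥ S *ᵥ v = 2) (hq : q ⬝ᵥ S *ᵥ q = 2)
    (hl : 2 + ε * (v ⬝ᵥ S *ᵥ q) ≠ 0) :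
    ∃ g : specialIsometryGroup S, toMat g = orbitSection S v ε q :=
  ⟨⟨⟨_, det_orbitSection hS hι hε hv hq hl⟩, orbitSection_isometry hS hε hv hq hl⟩, rfl⟩

theorem exists_toMat_mulVec_eq [CharZero k] (hS : S.transpose = S) (hι : Even (Fintype.card ι))
    (hv : v ⬝ᵥ S *ᵥ v = 2) (hq : q ⬝ᵥ S *ᵥ q = 2) :
    ∃ g : specialIsometryGroup S, toMat g *ᵥ v = q := by
  have key (ε : k) (hε : ε * ε = 1) (hl : 2 + ε * (v ⬝ᵥ S *ᵥ q) ≠ 0) :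
      ∃ g : specialIsometryGroup S, toMat g *ᵥ v = q := by
    obtain ⟨g, hg⟩ := exists_toMat_eq_orbitSection hS hι hε hv hq hl
    exact ⟨g, by rw [hg, orbitSection_mulVec hS hε hv hl]⟩
  by_cases hl : 2 + 1 * (v ⬝ᵥ S *ᵥ q) = 0
  -- The two denominators add up to `4`, so at least one section is defined at `q`.
  · refine key (-1) (by ring) fun h => ?_
    have : (4 : k) = 0 := by linear_combination hl + h
    norm_num at this
  · exact key 1 (by ring) hl

/-- A regular function that is invariant on the right under the stabilizer of a vector of
norm two factors polynomially through the orbit map. -/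
theorem exists_polynomial_of_stabilizer_invariant [CharZero k] (hS : S.transpose = S)
    (hι : Even (Fintype.card ι)) (hv : v ⬝ᵥ S *ᵥ v = 2) {F : specialIsometryGroup S → k}
    (hF : F ∈ regularFunctions S)
    (hinv : ∀ g h : specialIsometryGroup S, toMat h *ᵥ v = v → F (g * h) = F g) :
    ∃ p : MvPolynomial ι k, ∀ g, F g = MvPolynomial.eval (toMat g *ᵥ v) p := by
  -- `F` is constant on the fibres of the orbit map, so its values can be computed on either
  -- section.
  have hfib (g g' : specialIsometryGroup S) (h : toMat g *ᵥ v = toMat g' *ᵥ v) : F g' = F g := by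
    rw [← hinv g (g⁻¹ * g'), mul_inv_cancel_left]
    rw [toMat_mul, ← mulVec_mulVec, ← h, mulVec_mulVec, toMat_inv_mul, one_mulVec]
  have key (ε : k) (hε : ε * ε = 1) : ∃ (N : ℕ) (p : MvPolynomial ι k), ∀ g,
      (2 + ε * (v ⬝ᵥ S *ᵥ (toMat g *ᵥ v))) ^ N * F g = MvPolynomial.eval (toMat g *ᵥ v) p := by
    obtain ⟨N, f, hf, h⟩ := exists_denominator_pow_mul_section hF v ε
    obtain ⟨p, hp⟩ := mem_polynomialFunctions.1
      (mul_mem (denominator_mem_polynomialFunctions S v ε) hf)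
    -- The extra factor of the denominator makes both sides vanish where the section is undefined,
    -- so the identity holds for every `g`.
    refine ⟨N + 1, p, fun g => ?_⟩
    rw [← hp, Pi.mul_apply]
    by_cases hl : 2 + ε * (v ⬝ᵥ S *ᵥ (toMat g *ᵥ v)) = 0
    · rw [hl]; simp
    · obtain ⟨g', hg'⟩ := exists_toMat_eq_orbitSection hS hι hε hv
        ((dotProduct_toMat_mulVec g v v).trans hv) hl
      have := hfib g' g (by rw [hg', orbitSection_mulVec hS hε hv hl])
      rw [this, ← h _ hl g' hg']
      ring
  obtain ⟨M, p, hp⟩ := key 1 (by ring)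
  obtain ⟨N, p', hp'⟩ := key (-1) (by ring)
  -- The denominators, as polynomials, are coprime, hence so are their powers; the Bézout
  -- coefficients combine `p` and `p'`.
  have hcop : IsCoprime
      (2 + 1 * ∑ i, MvPolynomial.C (vecMul v S i) * MvPolynomial.X i : MvPolynomial ι k)
      (2 + (-1) * ∑ i, MvPolynomial.C (vecMul v S i) * MvPolynomial.X i) := by
    refine ⟨MvPolynomial.C (1 / 4), MvPolynomial.C (1 / 4), ?_⟩
    have h4 : (MvPolynomial.C (1 / 4) * 4 : MvPolynomial ι k) = 1 := by
      rw [show (4 : MvPolynomial ι k) = MvPolynomial.C 4 from (map_ofNat _ 4).symm, ← map_mul]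
      norm_num
    linear_combination h4
  obtain ⟨a, b, hab⟩ := hcop.pow (m := M) (n := N)
  refine ⟨a * p + b * p', fun g => ?_⟩
  have h := congrArg (MvPolynomial.eval (toMat g *ᵥ v)) hab
  have hp := hp g
  have hp' := hp' g
  simp only [map_add, map_mul, map_pow, map_sum, map_neg, map_one, map_ofNat,
    MvPolynomial.eval_C, MvPolynomial.eval_X] at h ⊢
  rw [dotProduct_mulVec v S, dotProduct] at hp hp'
  rw [← hp, ← hp']
  linear_combination (-F g) * h

end

end Reflections

/-! ### Invariants of the diagonal torus. -/

section Torus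

variable {k : Type*} [Field k] {n : ℕ}

theorem exists_mem_diagonalTorus (t : Fin n → kˣ) : ∃ a ∈ diagonalTorus k n, toMat a =
    Matrix.diagonal (Sum.elim (fun i => (t i : k)) (fun i => ((t i)⁻¹ : kˣ))) := by
  refine ⟨⟨⟨Matrix.diagonal (Sum.elim (fun i => (t i : k)) (fun i => ((t i)⁻¹ : kˣ))), ?_⟩, ?_⟩,
    ⟨t, rfl⟩, rfl⟩
  · rw [det_diagonal, Fintype.prod_sum_type, ← Finset.prod_mul_distrib]
    simp
  · change (Matrix.diagonal _).transpose * evenForm k n * Matrix.diagonal _ = evenForm k n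
    ext (i | i) (j | j) <;>
      simp only [diagonal_transpose, diagonal_mul, mul_diagonal, evenForm, fromBlocks_apply₁₁,
        fromBlocks_apply₁₂, fromBlocks_apply₂₁, fromBlocks_apply₂₂, Matrix.zero_apply, mul_zero, zero_mul,
        Sum.elim_inl, Sum.elim_inr, one_apply]
    all_goals split_ifs with h <;> simp [h]

/-- The character of `(kˣ)^n` through which it acts on the value of a monomial. -/
def weightCharacter (k : Type*) [Field k] (m : Fin n ⊕ Fin n →₀ ℕ) : (Fin n → kˣ) →* k where
  toFun t := ∏ i, (t i : k) ^ m (Sum.inl i) * (((t i)⁻¹ : kˣ) : k) ^ m (Sum.inr i)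
  map_one' := by simp
  map_mul' s t := by
    rw [← Finset.prod_mul_distrib]
    refine Finset.prod_congr rfl fun i _ => ?_
    simp only [Pi.mul_apply, mul_inv, Units.val_mul, mul_pow]
    ring

/-- In characteristic zero, `2` has infinite order in `kˣ`, so placing it in one coordinate detects
the exponents there. -/
theorem weightCharacter_eq_one_iff [CharZero k] (m : Fin n ⊕ Fin n →₀ ℕ) :
    weightCharacter k m = 1 ↔ ∀ i, m (Sum.inl i) = m (Sum.inr i) := by
  constructor
  · intro h i
    have h2 : (2 : k) ≠ 0 := two_ne_zero
    have := DFunLike.congr_fun h (Function.update (1 : Fin n → kˣ) i (Units.mk0 2 h2))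
    simp only [weightCharacter, MonoidHom.coe_mk, OneHom.coe_mk, MonoidHom.one_apply] at this
    rw [Finset.prod_eq_single i (fun j _ hj => by simp [Function.update_of_ne hj])
      (fun hi => absurd (Finset.mem_univ i) hi)] at this
    simp only [Function.update_self, Units.val_inv_eq_inv_val, Units.val_mk0, inv_pow] at this
    rw [mul_inv_eq_one₀ (pow_ne_zero _ h2)] at this
    have h' : ((2 ^ m (Sum.inl i) : ℕ) : k) = ((2 ^ m (Sum.inr i) : ℕ) : k) := by
      push_cast; exact this
    exact Nat.pow_right_injective le_rfl (Nat.cast_injective h')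
  · intro h
    refine MonoidHom.ext fun t => ?_
    simp only [weightCharacter, MonoidHom.coe_mk, OneHom.coe_mk, MonoidHom.one_apply]
    refine Finset.prod_eq_one fun i _ => ?_
    rw [h i, ← mul_pow, Units.mul_inv, one_pow]

open Classical in
/-- The component of torus weight zero of a polynomial. -/
noncomputable def weightZeroPart (p : MvPolynomial (Fin n ⊕ Fin n) k) :
    MvPolynomial (Fin n ⊕ Fin n) k :=
  ∑ m ∈ p.support with ∀ i, m (Sum.inl i) = m (Sum.inr i), MvPolynomial.monomial m (p.coeff m)

theorem weightZeroPart_mem_range (p : MvPolynomial (Fin n ⊕ Fin n) k) :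
    weightZeroPart p ∈ (zHom k n).range := by
  classical
  refine sum_mem fun m hm => ?_
  have hm := (Finset.mem_filter.1 hm).2
  refine ⟨MvPolynomial.C (p.coeff m) * ∏ i, MvPolynomial.X i ^ m (Sum.inl i), ?_⟩
  rw [MvPolynomial.monomial_eq, Finsupp.prod_fintype _ _ (fun _ => pow_zero _),
    Fintype.prod_sum_type, ← Finset.prod_mul_distrib]
  change zHom k n _ = _
  simp only [zHom, map_mul, map_prod, map_pow, MvPolynomial.aeval_X,
    MvPolynomial.algHom_C, MvPolynomial.algebraMap_eq, mul_pow, hm]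

theorem eval_diagonal_mulVec (t : Fin n → kˣ) (y : Fin n ⊕ Fin n → k)
    (p : MvPolynomial (Fin n ⊕ Fin n) k) :
    MvPolynomial.eval (Matrix.diagonal (Sum.elim (fun i => (t i : k))
      (fun i => (((t i)⁻¹ : kˣ) : k))) *ᵥ y) p =
      ∑ m ∈ p.support, MvPolynomial.eval y (MvPolynomial.monomial m (p.coeff m)) *
        weightCharacter k m t := by
  rw [MvPolynomial.eval_eq']
  refine Finset.sum_congr rfl fun m _ => ?_
  simp only [MvPolynomial.eval_monomial, Finsupp.prod_fintype _ _ (fun _ => pow_zero _),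
    mulVec_diagonal, Fintype.prod_sum_type, Sum.elim_inl, Sum.elim_inr, mul_pow,
    Finset.prod_mul_distrib, weightCharacter, MonoidHom.coe_mk, OneHom.coe_mk]
  ring

/-- A polynomial that is constant on a torus orbit takes the same value as its component of weight
zero there. -/
theorem eval_weightZeroPart_of_forall [CharZero k] {p : MvPolynomial (Fin n ⊕ Fin n) k}
    {y : Fin n ⊕ Fin n → k} {c : k}
    (h : ∀ a ∈ diagonalTorus k n, MvPolynomial.eval (toMat a *ᵥ y) p = c) :
    MvPolynomial.eval y (weightZeroPart p) = c := by
  classical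
  set A : (Fin n ⊕ Fin n →₀ ℕ) → k :=
    fun m => MvPolynomial.eval y (MvPolynomial.monomial m (p.coeff m))
  -- Constancy on the orbit is a linear relation among characters. Distinct monomials may share a
  -- character, so coefficients are collected by character; the coefficient of the trivial one gives
  -- the claim.
  set l : ((Fin n → kˣ) →* k) →₀ k :=
    ∑ m ∈ p.support, Finsupp.single (weightCharacter k m) (A m) - Finsupp.single 1 c
  have hl : Finsupp.linearCombination k
      (fun f : (Fin n → kˣ) →* k => (f : (Fin n → kˣ) → k)) l = 0 := by
    ext t
    obtain ⟨a, ha, hat⟩ := exists_mem_diagonalTorus t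
    have := h a ha
    rw [hat, eval_diagonal_mulVec] at this
    simp [l, A, ← this]
  have hz := DFunLike.congr_fun
    ((linearIndependent_iff.1 (linearIndependent_monoidHom (Fin n → kˣ) k)) l hl) 1
  simp only [l, Finsupp.sub_apply, Finsupp.finsetSum_apply, Finsupp.single_apply,
    weightCharacter_eq_one_iff, if_true, Finsupp.zero_apply] at hz
  rw [weightZeroPart, map_sum, Finset.sum_filter]
  exact sub_eq_zero.1 hz

theorem eval_zHom (y : Fin n ⊕ Fin n → k) (p : MvPolynomial (Fin n) k) :
    MvPolynomial.eval y (zHom k n p) =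
      MvPolynomial.eval (fun i => y (Sum.inl i) * y (Sum.inr i)) p := by
  rw [zHom]
  induction p using MvPolynomial.induction_on with
  | C a => simp
  | add p q hp hq => simp only [map_add, hp, hq]
  | mul_X p i hp => simp only [map_mul, hp, MvPolynomial.aeval_X, MvPolynomial.eval_X]

theorem zHom_mem_torusInvariants (p : MvPolynomial (Fin n) k) :
    zHom k n p ∈ torusInvariants k n := by
  rintro a ⟨t, ht⟩ y
  rw [eval_zHom, eval_zHom, ht]
  refine congrArg (fun z => MvPolynomial.eval z p) (funext fun i => ?_)
  simp only [mulVec_diagonal, Sum.elim_inl, Sum.elim_inr]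
  rw [mul_mul_mul_comm, Units.mul_inv, one_mul]

theorem range_zHom [CharZero k] : (zHom k n).range = torusInvariants k n := by
  refine le_antisymm ?_ fun p hp => ?_
  · rintro _ ⟨p, rfl⟩
    exact zHom_mem_torusInvariants p
  · have : p = weightZeroPart p := MvPolynomial.funext fun y =>
      (eval_weightZeroPart_of_forall fun a ha => hp a ha y).symm
    rw [this]
    exact weightZeroPart_mem_range p

/-- At the points `(y, 1)` the functions `z_i` take the arbitrary values `y_i`. -/
theorem zHom_injective [CharZero k] : Function.Injective (zHom k n) := by
  refine fun p q h => MvPolynomial.funext fun y => ?_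
  have := congrArg (MvPolynomial.eval (Sum.elim y 1)) h
  simpa [eval_zHom] using this

end Torus

/-! ### The hyperplane of coordinate sum one. -/

section Hyperplane

variable {k : Type*} [Field k] {m : ℕ}

/-- The parametrization of the hyperplane of vectors with coordinate sum one by the last
coordinates. -/
noncomputable def hyperplaneHom (k : Type*) [Field k] (m : ℕ) :
    MvPolynomial (Fin (m + 1)) k →ₐ[k] MvPolynomial (Fin m) k :=
  MvPolynomial.aeval (Fin.cons (1 - ∑ i, MvPolynomial.X i) MvPolynomial.X)

/-- The inclusion of the polynomials in the last coordinates. -/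
noncomputable def tailHom (k : Type*) [Field k] (m : ℕ) :
    MvPolynomial (Fin m) k →ₐ[k] MvPolynomial (Fin (m + 1)) k :=
  MvPolynomial.rename Fin.succ

theorem hyperplaneHom_tailHom (p : MvPolynomial (Fin m) k) :
    hyperplaneHom k m (tailHom k m p) = p := by
  rw [hyperplaneHom, tailHom, MvPolynomial.aeval_rename]
  exact MvPolynomial.aeval_X_left_apply p

/-- Both maps to the quotient are algebra homomorphisms, so only the variables need checking; the
first variable is eliminated by the equation of the hyperplane. -/
theorem tailHom_hyperplaneHom_sub_mem (p : MvPolynomial (Fin (m + 1)) k) :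
    tailHom k m (hyperplaneHom k m p) - p ∈
      Ideal.span {(∑ i, MvPolynomial.X i : MvPolynomial (Fin (m + 1)) k) - 1} := by
  rw [← Ideal.Quotient.mk_eq_mk_iff_sub_mem, ← Ideal.Quotient.mkₐ_eq_mk k]
  rw [← AlgHom.comp_apply, ← AlgHom.comp_apply]
  refine DFunLike.congr_fun (MvPolynomial.algHom_ext fun i => ?_) p
  rw [AlgHom.comp_apply, AlgHom.comp_apply, Ideal.Quotient.mkₐ_eq_mk,
    Ideal.Quotient.mk_eq_mk_iff_sub_mem, hyperplaneHom, tailHom, MvPolynomial.aeval_X]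
  refine Fin.cases ?_ (fun j => ?_) i
  · refine Ideal.mem_span_singleton.2 ⟨-1, ?_⟩
    simp only [Fin.cons_zero, map_sub, map_one, map_sum, MvPolynomial.rename_X, Fin.sum_univ_succ]
    ring
  · simp

theorem ker_hyperplaneHom : RingHom.ker (hyperplaneHom k m) =
    Ideal.span {(∑ i, MvPolynomial.X i : MvPolynomial (Fin (m + 1)) k) - 1} := by
  refine le_antisymm (fun p hp => ?_) ?_
  · have := tailHom_hyperplaneHom_sub_mem p
    rwa [RingHom.mem_ker.1 hp, map_zero, zero_sub, neg_mem_iff] at this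
  · rw [Ideal.span_singleton_le_iff_mem, RingHom.mem_ker]
    simp [hyperplaneHom, Fin.sum_univ_succ]

theorem eval_hyperplaneHom (y : Fin m → k) (p : MvPolynomial (Fin (m + 1)) k) :
    MvPolynomial.eval y (hyperplaneHom k m p) =
      MvPolynomial.eval (Fin.cons (1 - ∑ i, y i) y : Fin (m + 1) → k) p := by
  rw [hyperplaneHom]
  induction p using MvPolynomial.induction_on with
  | C a => simp
  | add p q hp hq => simp only [map_add, hp, hq]
  | mul_X p i hp =>
    rw [map_mul, map_mul, hp, map_mul, MvPolynomial.aeval_X, MvPolynomial.eval_X]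
    congr 1
    refine Fin.cases ?_ (fun j => ?_) i <;> simp

/-- The pointwise form of the kernel, which is the one that can be compared with the orbit map; it
rests on `k` being infinite. -/
theorem mem_ker_hyperplaneHom_iff [CharZero k] (p : MvPolynomial (Fin (m + 1)) k) :
    p ∈ RingHom.ker (hyperplaneHom k m) ↔
      ∀ z : Fin (m + 1) → k, ∑ i, z i = 1 → MvPolynomial.eval z p = 0 := by
  rw [RingHom.mem_ker]
  constructor
  · intro h z hz
    have := eval_hyperplaneHom (Fin.tail z) p
    rw [h, map_zero] at this
    rw [Fin.sum_univ_succ] at hz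
    have hz' : 1 - ∑ i, Fin.tail z i = z 0 := (eq_sub_of_add_eq hz).symm
    rwa [hz', Fin.cons_self_tail, eq_comm] at this
  · intro h
    refine MvPolynomial.funext fun y => ?_
    rw [eval_hyperplaneHom, map_zero]
    exact h _ (by simp [Fin.sum_univ_succ])

end Hyperplane

/-! ### From polynomial algebras to affine space over `k`. -/

section Scheme

universe u

variable {k : Type u} [Field k]

theorem nonempty_iso_affineSpaceOver {A : Type u} [CommRing A] [Algebra k A] {d : ℕ}
    (e : A ≃ₐ[k] MvPolynomial (Fin d) k) :
    Nonempty (Over.mk (Spec.map (CommRingCat.ofHom (algebraMap k A))) ≅ affineSpaceOver k d) := by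
  let e' : A ≃ₐ[k] MvPolynomial (ULift.{u} (Fin d)) k :=
    e.trans (MvPolynomial.renameEquiv k Equiv.ulift.symm)
  let i : Spec (CommRingCat.of A) ≅ Spec (CommRingCat.of (MvPolynomial (ULift.{u} (Fin d)) k)) :=
    Scheme.Spec.mapIso e'.symm.toRingEquiv.toCommRingCatIso.op
  refine ⟨Over.isoMk (i ≪≫ (AffineSpace.SpecIso (ULift.{u} (Fin d)) (CommRingCat.of k)).symm) ?_⟩
  simp only [affineSpaceOver, Over.mk_hom, Iso.trans_hom, Iso.symm_hom, Category.assoc]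
  erw [AffineSpace.SpecIso_inv_over]
  change Spec.map _ ≫ Spec.map _ = Spec.map _
  rw [← Spec.map_comp]
  congr 1
  ext x
  exact e'.symm.commutes x

end Scheme

/-! ### The normal vector of an isometric embedding of codimension one. -/

section Complement

variable {k ι κ : Type*} [Field k] [Fintype ι] [DecidableEq ι] [Fintype κ] [DecidableEq κ]
  {S : Matrix ι ι k} {O : Matrix κ κ k} {W : Matrix ι κ k}

/-- An isometric embedding of codimension one into a quadratic space has a normal vector with
nonzero norm. -/
theorem exists_normal_ne_zero [CharZero k] (hS : S.transpose = S) (hSS : S * S = 1)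
    (hOO : O * O = 1) (hW : W.transpose * S * W = O)
    (hcard : Fintype.card ι = Fintype.card κ + 1) :
    ∃ w : ι → k, W.transpose *ᵥ S *ᵥ w = 0 ∧ w ⬝ᵥ S *ᵥ w ≠ 0 := by
  have hO : O.transpose = O := by
    rw [← hW, transpose_mul, transpose_mul, transpose_transpose, hS, Matrix.mul_assoc]
  -- The orthogonal projection onto the complement of the image of `W`; its trace is the
  -- codimension, so it is nonzero.
  set P : Matrix ι ι k := 1 - W * O * W.transpose * S
  have hWP : W.transpose * S * P = 0 := by
    have : W.transpose * S * (W * O * W.transpose * S) =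
        (W.transpose * S * W) * O * (W.transpose * S) := by simp only [Matrix.mul_assoc]
    rw [Matrix.mul_sub, this, hW, hOO, Matrix.mul_one, Matrix.one_mul, sub_self]
  have hPS : P.transpose * S = S * P := by
    simp only [P, transpose_sub, transpose_one, transpose_mul, transpose_transpose, hS, hO,
      sub_mul, mul_sub, one_mul, mul_one, Matrix.mul_assoc]
  have hPP : P.transpose * S * P = S * P := by
    rw [hPS]
    have : S * P * P = S * P - S * W * O * (W.transpose * S * P) := by
      nth_rewrite 1 [show P = 1 - W * O * W.transpose * S from rfl]
      simp only [mul_sub, sub_mul, mul_one, Matrix.mul_assoc]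
    rw [this, hWP, Matrix.mul_zero, sub_zero]
  have htr : P.trace = 1 := by
    have : (W * O * W.transpose * S).trace = (Fintype.card κ : k) := by
      rw [Matrix.mul_assoc, Matrix.mul_assoc, trace_mul_comm, Matrix.mul_assoc, hW, hOO, trace_one]
    rw [trace_sub, trace_one, this, hcard]
    push_cast; ring
  have hSP : S * P ≠ 0 := by
    intro h
    have : P = 0 := by
      rw [← one_mul P, ← hSS, Matrix.mul_assoc, h, mul_zero]
    rw [this, trace_zero] at htr
    exact zero_ne_one htr
  have hker (x : ι → k) : W.transpose *ᵥ S *ᵥ P *ᵥ x = 0 := by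
    rw [mulVec_mulVec, mulVec_mulVec, hWP, zero_mulVec]
  have hval (x y : ι → k) : (P *ᵥ x) ⬝ᵥ S *ᵥ (P *ᵥ y) = x ⬝ᵥ (S * P) *ᵥ y := by
    conv_rhs => rw [← hPP]
    rw [dotProduct_comm, dotProduct_mulVec, ← mulVec_transpose, dotProduct_comm, mulVec_mulVec,
      mulVec_mulVec, Matrix.mul_assoc]
  -- If every normal vector were isotropic, polarization would kill the symmetric form `S * P`.
  by_contra! hcon
  have hz (x : ι → k) : x ⬝ᵥ (S * P) *ᵥ x = 0 := by rw [← hval, hcon _ (hker x)]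
  have hsym : (S * P).transpose = S * P := by rw [transpose_mul, hS, hPS]
  refine hSP (Matrix.ext fun i j => ?_)
  have h := hz (Pi.single i 1 + Pi.single j 1)
  rw [mulVec_add, dotProduct_add, add_dotProduct, add_dotProduct, hz, hz,
    dotProduct_mulVec_symm hsym (Pi.single j 1)] at h
  simp only [single_one_dotProduct, mulVec_single_one, col_apply, zero_add, add_zero] at h
  rw [← two_mul] at h
  exact (mul_eq_zero.1 h).resolve_left two_ne_zero

/-- Rescaling to norm `2` takes a square root, hence the algebraically closed field. -/
theorem exists_normal [CharZero k] [IsAlgClosed k] (hS : S.transpose = S) (hSS : S * S = 1)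
    (hOO : O * O = 1) (hW : W.transpose * S * W = O)
    (hcard : Fintype.card ι = Fintype.card κ + 1) :
    ∃ v : ι → k, W.transpose *ᵥ S *ᵥ v = 0 ∧ v ⬝ᵥ S *ᵥ v = 2 := by
  obtain ⟨w, hw, hw0⟩ := exists_normal_ne_zero hS hSS hOO hW hcard
  obtain ⟨c, hc⟩ := IsAlgClosed.exists_pow_nat_eq (2 / (w ⬝ᵥ S *ᵥ w)) two_pos
  refine ⟨c • w, by rw [mulVec_smul, mulVec_smul, hw, smul_zero], ?_⟩
  rw [mulVec_smul, dotProduct_smul, smul_dotProduct, smul_smul, ← pow_two, hc, smul_eq_mul,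
    div_mul_cancel₀ _ hw0]

variable {v : ι → k}

omit [DecidableEq ι] in
theorem fromRows_mul_fromCols_eq_one [CharZero k] (hOO : O * O = 1)
    (hW : W.transpose * S * W = O) (hv : W.transpose *ᵥ S *ᵥ v = 0) (hvv : v ⬝ᵥ S *ᵥ v = 2) :
    fromRows (O * W.transpose * S) (replicateRow Unit ((1 / 2 : k) • S *ᵥ v)) *
      fromCols W (replicateCol Unit v) = 1 := by
  have h11 : O * W.transpose * S * W = 1 := by
    rw [Matrix.mul_assoc, Matrix.mul_assoc, ← Matrix.mul_assoc W.transpose, hW, hOO]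
  have h12 : O * W.transpose * S * replicateCol Unit v = 0 := by
    rw [Matrix.mul_assoc, Matrix.mul_assoc, ← replicateCol_mulVec, ← replicateCol_mulVec, hv,
      replicateCol_zero, Matrix.mul_zero]
  have h21 : replicateRow Unit ((1 / 2 : k) • S *ᵥ v) * W = 0 := by
    rw [← replicateRow_vecMul, smul_vecMul, ← mulVec_transpose, hv, smul_zero, replicateRow_zero]
  have h22 : replicateRow Unit ((1 / 2 : k) • S *ᵥ v) * replicateCol Unit v = 1 := by
    ext i j
    rw [replicateRow_mul_replicateCol_apply, smul_dotProduct, dotProduct_comm, hvv, smul_eq_mul,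
      one_div_mul_cancel two_ne_zero, one_apply_eq]
  rw [fromRows_mul_fromCols, h11, h12, h21, h22, fromBlocks_one]

/-- The matrix with columns `W` and `v` is square, so its left inverse is also a right inverse; this
resolves the identity into the projections onto the image of `W` and onto the line of `v`. -/
theorem complement_eq_one [CharZero k] (hOO : O * O = 1)
    (hW : W.transpose * S * W = O) (hcard : Fintype.card ι = Fintype.card κ + 1)
    (hv : W.transpose *ᵥ S *ᵥ v = 0) (hvv : v ⬝ᵥ S *ᵥ v = 2) :
    W * (O * W.transpose * S) + vecMulVec v ((1 / 2 : k) • S *ᵥ v) = 1 := by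
  have h := fromRows_mul_fromCols_eq_one hOO hW hv hvv
  rw [mul_eq_one_comm_of_card_eq _ _ _ (by simp [hcard]), fromCols_mul_fromRows,
    ← vecMulVec_eq] at h
  exact h

/-- An isometry of determinant one that fixes the normal vector of the image of `W` acts on that
image through an isometry of determinant one. -/
theorem exists_specialIsometry_of_fixes [CharZero k] (hOO : O * O = 1)
    (hW : W.transpose * S * W = O) (hcard : Fintype.card ι = Fintype.card κ + 1)
    (hv : W.transpose *ᵥ S *ᵥ v = 0) (hvv : v ⬝ᵥ S *ᵥ v = 2)
    (g : specialIsometryGroup S) (hg : toMat g *ᵥ v = v) :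
    ∃ h : specialIsometryGroup O, toMat g * W = W * toMat h := by
  have hiso : (toMat g).transpose * S * toMat g = S := g.2
  set G := toMat g
  -- An isometry fixing `v` preserves its orthogonal complement, so `G` maps the image of `W` into
  -- itself.
  have hvgW : (S *ᵥ v) ᵥ* (G * W) = 0 := by
    have h1 : G.transpose *ᵥ S *ᵥ v = S *ᵥ v := by
      conv_lhs => rw [← hg]
      rw [mulVec_mulVec, mulVec_mulVec, hiso]
    rw [← vecMul_vecMul, ← mulVec_transpose _ (S *ᵥ v), h1, ← mulVec_transpose, hv]
  set H : Matrix κ κ k := O * W.transpose * S * (G * W)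
  have hGW : G * W = W * H := by
    conv_lhs => rw [← Matrix.one_mul (G * W), ← complement_eq_one hOO hW hcard hv hvv]
    have h0 : vecMulVec v (0 : κ → k) = 0 := by ext; simp [vecMulVec_apply]
    rw [Matrix.add_mul, vecMulVec_mul, smul_vecMul, hvgW, smul_zero, h0, add_zero,
      Matrix.mul_assoc]
  have hLM := fromRows_mul_fromCols_eq_one hOO hW hv hvv
  have hML := (mul_eq_one_comm_of_card_eq _ _ _ (by simp [hcard])).1 hLM
  have hdet := det_conj_of_mul_eq_one (M := fromRows (O * W.transpose * S)
    (replicateRow Unit ((1 / 2 : k) • S *ᵥ v))) (N := G) hLM hML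
  -- In the basis formed by `W` and `v`, `G` is block diagonal with blocks `H` and `1`, whence `det
  -- H = det G`.
  have hGM : G * fromCols W (replicateCol Unit v) =
      fromCols W (replicateCol Unit v) * fromBlocks H 0 0 (1 : Matrix Unit Unit k) := by
    rw [mul_fromCols, fromCols_mul_fromBlocks, ← replicateCol_mulVec, hg, hGW]
    simp
  rw [Matrix.mul_assoc, hGM, ← Matrix.mul_assoc, hLM, one_mul, det_fromBlocks_zero₂₁, det_one,
    mul_one] at hdet
  refine ⟨⟨⟨H, hdet.trans g.1.2⟩, ?_⟩, hGW⟩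
  change H.transpose * O * H = O
  calc H.transpose * O * H = (W * H).transpose * S * (W * H) := by
        conv_lhs => rw [← hW]
        simp only [transpose_mul, Matrix.mul_assoc]
    _ = W.transpose * (G.transpose * S * G) * W := by
        rw [← hGW]; simp only [transpose_mul, Matrix.mul_assoc]
    _ = O := by rw [hiso, hW]

/-- The orthogonal complement of the image of `W` is spanned by the normal vector. -/
theorem eq_smul_of_orthogonal [CharZero k] (hOO : O * O = 1)
    (hW : W.transpose * S * W = O) (hcard : Fintype.card ι = Fintype.card κ + 1)
    (hv : W.transpose *ᵥ S *ᵥ v = 0) (hvv : v ⬝ᵥ S *ᵥ v = 2)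
    {w : ι → k} (hw : W.transpose *ᵥ S *ᵥ w = 0) : ∃ c : k, w = c • v := by
  refine ⟨((1 / 2 : k) • S *ᵥ v) ⬝ᵥ w, ?_⟩
  conv_lhs => rw [← one_mulVec w, ← complement_eq_one hOO hW hcard hv hvv]
  rw [add_mulVec, Matrix.mul_assoc O, ← mulVec_mulVec, ← mulVec_mulVec, ← mulVec_mulVec, hw,
    mulVec_zero, mulVec_zero, zero_add, vecMulVec_mulVec]
  ext i
  simp [mul_comm]

end Complement

/-! ### The double coset algebra of the even orthogonal group. -/

section Main

variable {k : Type*} [Field k] {n m : ℕ}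

theorem evenForm_transpose : (evenForm k n).transpose = evenForm k n := by
  simp [evenForm, fromBlocks_transpose]

theorem evenForm_mul_self : evenForm k n * evenForm k n = 1 := by
  simp [evenForm, fromBlocks_multiply]

theorem oddForm_mul_self : oddForm k m * oddForm k m = 1 := by
  simp [oddForm, fromBlocks_multiply, evenForm_mul_self]

/-- The factor `2` is why the quadric `∑ x_i x'_i = 1` consists of the vectors of norm `2`. -/
theorem dotProduct_evenForm_self (v : Fin n ⊕ Fin n → k) :
    v ⬝ᵥ evenForm k n *ᵥ v = 2 * ∑ i, v (Sum.inl i) * v (Sum.inr i) := by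
  rw [evenForm, fromBlocks_mulVec, dotProduct, Fintype.sum_sum_type]
  simp only [zero_mulVec, one_mulVec, zero_add, add_zero, Sum.elim_inl, Sum.elim_inr,
    Function.comp_apply, mul_comm (v (Sum.inr _)), two_mul]

theorem even_card_sum_self : Even (Fintype.card (Fin n ⊕ Fin n)) := ⟨n, by simp⟩

theorem orbitPullback_apply (v : Fin n ⊕ Fin n → k) (p : MvPolynomial (Fin n ⊕ Fin n) k)
    (g : SOEven k n) : orbitPullback v p g = MvPolynomial.eval (toMat g *ᵥ v) p := by
  rw [orbitPullback]
  induction p using MvPolynomial.induction_on with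
  | C a => simp
  | add p q hp hq => rw [map_add, map_add, Pi.add_apply, hp, hq]
  | mul_X p i hp =>
    rw [map_mul, map_mul, Pi.mul_apply, hp, MvPolynomial.aeval_X, MvPolynomial.eval_X]

theorem orbitPullback_mem_regularFunctions (v : Fin n ⊕ Fin n → k)
    (p : MvPolynomial (Fin n ⊕ Fin n) k) :
    orbitPullback v p ∈ regularFunctions (evenForm k n) := by
  rw [orbitPullback]
  induction p using MvPolynomial.induction_on with
  | C a => rw [MvPolynomial.aeval_C]; exact Subalgebra.algebraMap_mem _ a
  | add p q hp hq => rw [map_add]; exact add_mem hp hq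
  | mul_X p i hp =>
    rw [map_mul, MvPolynomial.aeval_X]
    refine mul_mem hp ?_
    have : (fun g : SOEven k n => (toMat g *ᵥ v) i) =
        ∑ j, v j • fun g : SOEven k n => toMat g i j := by
      ext g
      simp only [mulVec, dotProduct, Finset.sum_apply, Pi.smul_apply, smul_eq_mul, mul_comm]
    rw [this]
    exact sum_mem fun j _ => Subalgebra.smul_mem _ (Algebra.subset_adjoin (Set.mem_range_self (i, j))) _

variable {W : Matrix (Fin n ⊕ Fin n) ((Fin m ⊕ Fin m) ⊕ Unit) k} {v : Fin n ⊕ Fin n → k}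

/-- The complement of the image of `W` is the line of `v`, so fixing `v` gives the trivial action
there; the action on the image then has determinant one automatically. -/
theorem mem_embeddedSOOdd_iff [CharZero k] (hnm : n = m + 1)
    (hW : W.transpose * evenForm k n * W = oddForm k m)
    (hv : W.transpose *ᵥ evenForm k n *ᵥ v = 0) (hvv : v ⬝ᵥ evenForm k n *ᵥ v = 2)
    (g : SOEven k n) : g ∈ embeddedSOOdd W ↔ toMat g *ᵥ v = v := by
  have hcard : Fintype.card (Fin n ⊕ Fin n) = Fintype.card ((Fin m ⊕ Fin m) ⊕ Unit) + 1 := by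
    simp [hnm]; ring
  refine ⟨fun h => h.2 v hv, fun h => ⟨?_, fun w hw => ?_⟩⟩
  · exact exists_specialIsometry_of_fixes oddForm_mul_self hW hcard hv hvv g h
  · obtain ⟨c, rfl⟩ :=
      eq_smul_of_orthogonal oddForm_mul_self hW hcard hv hvv hw
    rw [mulVec_smul, h]

theorem range_orbitPullback_comp_zHom [CharZero k] (hnm : n = m + 1)
    (hW : W.transpose * evenForm k n * W = oddForm k m)
    (hv : W.transpose *ᵥ evenForm k n *ᵥ v = 0) (hvv : v ⬝ᵥ evenForm k n *ᵥ v = 2) :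
    ((orbitPullback v).comp (zHom k n)).range =
      doubleInvariants (diagonalTorus k n) (embeddedSOOdd W) := by
  have hH := mem_embeddedSOOdd_iff hnm hW hv hvv
  refine le_antisymm ?_ fun F hF => ?_
  · rintro _ ⟨p, rfl⟩
    refine ⟨orbitPullback_mem_regularFunctions v _, fun a ha b hb g => ?_⟩
    change orbitPullback v (zHom k n p) _ = orbitPullback v (zHom k n p) _
    rw [orbitPullback_apply, orbitPullback_apply, toMat_mul, ← mulVec_mulVec,
      (hH _).1 (inv_mem hb), toMat_mul, ← mulVec_mulVec, zHom_mem_torusInvariants p a ha]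
  · obtain ⟨hreg, hinv⟩ := hF
    obtain ⟨p, hp⟩ := exists_polynomial_of_stabilizer_invariant evenForm_transpose
      even_card_sum_self hvv hreg fun g h hh => by
        have := hinv 1 (one_mem _) h⁻¹ (inv_mem ((hH h).2 hh)) g
        rwa [one_mul, inv_inv] at this
    obtain ⟨p₀, hp₀⟩ := weightZeroPart_mem_range p
    refine ⟨p₀, funext fun g => ?_⟩
    change orbitPullback v (zHom k n p₀) g = F g
    rw [show zHom k n p₀ = weightZeroPart p from hp₀, orbitPullback_apply]
    refine eval_weightZeroPart_of_forall fun a ha => ?_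
    rw [mulVec_mulVec, ← toMat_mul, ← hp]
    have := hinv a ha 1 (one_mem _) g
    rwa [inv_one, mul_one] at this

theorem ker_orbitPullback_comp_zHom [CharZero k] {v : Fin (m + 1) ⊕ Fin (m + 1) → k}
    (hvv : v ⬝ᵥ evenForm k (m + 1) *ᵥ v = 2) :
    RingHom.ker ((orbitPullback v).comp (zHom k (m + 1))) = RingHom.ker (hyperplaneHom k m) := by
  ext p
  rw [mem_ker_hyperplaneHom_iff, RingHom.mem_ker, funext_iff]
  have happ (g : SOEven k (m + 1)) : (orbitPullback v).comp (zHom k (m + 1)) p g =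
      MvPolynomial.eval
        (fun i => (toMat g *ᵥ v) (Sum.inl i) * (toMat g *ᵥ v) (Sum.inr i)) p := by
    rw [AlgHom.comp_apply, orbitPullback_apply, eval_zHom]
  simp only [happ, Pi.zero_apply]
  constructor
  · intro h z hz
    -- The vector with `x_i = z_i` and `x'_i = 1` lies on the quadric above `z`; by transitivity it
    -- equals `g v` for some `g`.
    obtain ⟨g, hg⟩ := exists_toMat_mulVec_eq (q := Sum.elim z 1) evenForm_transpose
      even_card_sum_self hvv (by simp [dotProduct_evenForm_self, hz])
    simpa [hg] using h g
  · refine fun h g => h _ (mul_left_cancel₀ (two_ne_zero (α := k)) ?_)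
    rw [← dotProduct_evenForm_self, dotProduct_toMat_mulVec, hvv, mul_one]

/-- The double coset algebra is the algebra of polynomials on the hyperplane. -/
theorem nonempty_doubleInvariants_algEquiv [CharZero k] [IsAlgClosed k]
    {W : Matrix (Fin (m + 1) ⊕ Fin (m + 1)) ((Fin m ⊕ Fin m) ⊕ Unit) k}
    (hW : W.transpose * evenForm k (m + 1) * W = oddForm k m) :
    Nonempty (doubleInvariants (diagonalTorus k (m + 1)) (embeddedSOOdd W) ≃ₐ[k]
      MvPolynomial (Fin m) k) := by
  obtain ⟨v, hv, hvv⟩ := exists_normal evenForm_transpose evenForm_mul_self oddForm_mul_self hW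
    (by simp; ring)
  have hsurj : Function.Surjective (hyperplaneHom k m) :=
    fun p => ⟨tailHom k m p, hyperplaneHom_tailHom p⟩
  set π := (orbitPullback v).comp (zHom k (m + 1))
  have hker : RingHom.ker π.rangeRestrict = RingHom.ker (hyperplaneHom k m) := by
    rw [AlgHom.ker_rangeRestrict]
    exact ker_orbitPullback_comp_zHom hvv
  -- Both algebras are quotients of `k[Z_1, …, Z_{m+1}]` by the same kernel.
  exact ⟨(Subalgebra.equivOfEq _ _ (range_orbitPullback_comp_zHom rfl hW hv hvv)).symm.trans
    ((Ideal.quotientKerAlgEquivOfSurjective π.rangeRestrict_surjective).symm.trans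
      ((Ideal.quotientEquivAlgOfEq k hker).trans (Ideal.quotientKerAlgEquivOfSurjective hsurj)))⟩

end Main

end DoubleCoset

theorem mainTheorem6 {k : Type*} [Field k] [IsAlgClosed k] [CharZero k] (n : ℕ) (hn : 1 ≤ n)
    (W : Matrix (Fin n ⊕ Fin n) ((Fin (n - 1) ⊕ Fin (n - 1)) ⊕ Unit) k)
    (hW : W.transpose * DoubleCoset.evenForm k n * W = DoubleCoset.oddForm k (n - 1)) :
    Nonempty (DoubleCoset.doubleInvariants (DoubleCoset.diagonalTorus k n)
        (DoubleCoset.embeddedSOOdd W) ≃ₐ[k] MvPolynomial (Fin (n - 1)) k) ∧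
    Nonempty (DoubleCoset.doubleCosetVariety (DoubleCoset.diagonalTorus k n)
        (DoubleCoset.embeddedSOOdd W) ≅ DoubleCoset.affineSpaceOver k (n - 1)) ∧
    (Function.Injective (DoubleCoset.zHom k n) ∧
      (DoubleCoset.zHom k n).range = DoubleCoset.torusInvariants k n) ∧
    ∀ v : Fin n ⊕ Fin n → k,
      W.transpose.mulVec ((DoubleCoset.evenForm k n).mulVec v) = 0 →
      ∑ i, v (Sum.inl i) * v (Sum.inr i) = 1 →
        ((DoubleCoset.orbitPullback v).comp (DoubleCoset.zHom k n)).range =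
            DoubleCoset.doubleInvariants (DoubleCoset.diagonalTorus k n)
              (DoubleCoset.embeddedSOOdd W) ∧
          RingHom.ker ((DoubleCoset.orbitPullback v).comp (DoubleCoset.zHom k n)) =
            Ideal.span {(∑ i, MvPolynomial.X i) - 1} := by
  obtain ⟨m, rfl⟩ : ∃ m, n = m + 1 := ⟨n - 1, (Nat.sub_add_cancel hn).symm⟩
  obtain ⟨e⟩ := DoubleCoset.nonempty_doubleInvariants_algEquiv (m := m) hW
  refine ⟨⟨e⟩, DoubleCoset.nonempty_iso_affineSpaceOver e,
    ⟨DoubleCoset.zHom_injective, DoubleCoset.range_zHom⟩, fun v hv hq => ?_⟩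
  have hvv : v ⬝ᵥ (DoubleCoset.evenForm k (m + 1)).mulVec v = 2 := by
    rw [DoubleCoset.dotProduct_evenForm_self, hq, mul_one]
  exact ⟨DoubleCoset.range_orbitPullback_comp_zHom (m := m) rfl hW hv hvv,
    (DoubleCoset.ker_orbitPullback_comp_zHom hvv).trans DoubleCoset.ker_hyperplaneHom⟩
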